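/- Conventions. The language $\lambda_M$ has one $k$-ary relation symbol $I_k$ for every integer $k\ge 1$, and first-order formulas may use equality. A matroid $M$ (finite, or infinite in the sense of Bruhn, Diestel, Kriesell, Pendavingh and Wollan) with ground set $E$ is viewed as a $\lambda_M$-structure on $E$ in which $I_k(x_1,\dots,x_k)$ holds if and only if $x_1,\dots,x_k$ are pairwise distinct and $\{x_1,\dots,x_k\}$ is independent in $M$. For a matroid $M$ with finite nonempty ground set $E$ and a first-order $\lambda_M$-formula $\varphi$ with $k\ge 0$ free variables, let $$\langle\varphi,M\rangle=\frac{\left|\{(x_1,\dots,x_k)\in E^k : M\models\varphi(x_1,\dots,x_k)\}\right|}{|E|^k}.$$ A sequence $(M_n)_{n\in\mathbb N}$ of such matroids is first-order convergent if $\langle\varphi,M_n\rangle$ converges as $n\to\infty$ for every first-order $\lambda_M$-formula $\varphi$. A $\lambda_M$-modeling is a $\lambda_M$-structure $\mathbf M$ whose domain is a standard Borel space equipped with a probability measure $\nu$ such that, for every $k\ge 0$ and every first-order formula $\varphi$ with $k$ free variables, the set $\mathbf M^\varphi$ of the $k$-tuples satisfying $\varphi$ is measurable with respect to the product measure $\nu^k$;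 put $\langle\varphi,\mathbf M\rangle=\nu^k(\mathbf M^\varphi)$. It is a limit modeling of $(M_n)_{n\in\mathbb N}$ if its structure is that of a (finite or infinite) matroid on its domain and $\langle\varphi,\mathbf M\rangle=\lim_{n\to\infty}\langle\varphi,M_n\rangle$ for every first-order $\lambda_M$-formula $\varphi$. A finite matroid is binary if it is representable over the two-element field $\mathbb F_2$. Theorem. There exists a first-order convergent sequence $(M_n)_{n\in\mathbb N}$ of finite binary matroids that has no limit modeling. -/

import Mathlib

universe u v

namespace FOMatroid

open MeasureTheory Filter Topology

/-- The relation symbols of the language of matroids: one `k`-ary symbol `I_k` for every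
positive integer `k`. -/
inductive IndepSymbol : ℕ → Type
  | indep (k : ℕ) : IndepSymbol (k + 1)

/-- The language of matroids. -/
def matroidLanguage : FirstOrder.Language.{0, 0} where
  Functions := fun _ => Empty
  Relations := IndepSymbol

/-- A tuple of elements is independent if its entries are pairwise distinct and form an
independent set. -/
def IndepTuple {α : Type u} (M : Matroid α) {k : ℕ} (x : Fin k → α) : Prop :=
  Function.Injective x ∧ M.Indep (Set.range x)

/-- The structure, in the language of matroids, on the ground set of a matroid: `I_k` holds for
the independent `k`-tuples. -/
@[reducible]
def groundStructure {α : Type u} (M : Matroid α) : matroidLanguage.Structure M.E where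
  funMap := fun f _ => nomatch f
  RelMap := fun r x =>
    match r, x with
    | .indep _, x => IndepTuple M (fun i => (x i : α))

/-- `M` is representable over the field `F`: the elements can be assigned vectors over `F` so that
independence in `M` is linear independence (as a family, so elements assigned equal vectors are
dependent). -/
def IsRepresentable (F : Type v) [Field F] {α : Type u} (M : Matroid α) : Prop :=
  ∃ (r : ℕ) (f : α → Fin r → F), ∀ I ⊆ M.E, M.Indep I ↔ LinearIndepOn F f I

/-- A binary matroid is a matroid representable over the two-element field. -/
def IsBinary {α : Type u} (M : Matroid α) : Prop :=
  IsRepresentable (ZMod 2) M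

/-- The Stone pairing of a first order formula with `k` free variables and a matroid with a finite
nonempty ground set `E` (carrying the uniform measure): the number of `k`-tuples satisfying the
formula divided by `|E| ^ k`. -/
noncomputable def finitePairing {α : Type u} (M : Matroid α) {k : ℕ}
    (φ : matroidLanguage.Formula (Fin k)) : ℝ :=
  letI := groundStructure M
  (Nat.card {x : Fin k → M.E // φ.Realize x} : ℝ) / (Nat.card M.E : ℝ) ^ k

/-- A sequence of matroids (with finite nonempty ground sets) is first order convergent if all its
Stone pairings converge. -/
def FOConvergent {α : Type u} (M : ℕ → Matroid α) : Prop :=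
  ∀ (k : ℕ) (φ : matroidLanguage.Formula (Fin k)),
    ∃ l : ℝ, Tendsto (fun n => finitePairing (M n) φ) atTop (𝓝 l)

/-- A modeling: a structure on a standard Borel space with a probability measure `ν` such that the
set of `k`-tuples satisfying a first order formula with `k` free variables is always measurable with
respect to the product measure `ν ^ k` (that is, it lies in the completed product
`σ`-algebra). -/
structure Modeling (L : FirstOrder.Language.{0, 0}) where
  carrier : Type u
  [str : L.Structure carrier]
  [mspace : MeasurableSpace carrier]
  [borel : StandardBorelSpace carrier]
  ν : Measure carrier
  [prob : IsProbabilityMeasure ν]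
  measurable_realize : ∀ (k : ℕ) (φ : L.Formula (Fin k)),
    NullMeasurableSet {x : Fin k → carrier | φ.Realize x} (Measure.pi fun _ => ν)

attribute [instance] Modeling.str Modeling.mspace Modeling.borel Modeling.prob

/-- The Stone pairing of a formula with `k` free variables and a modeling. -/
noncomputable def Modeling.pairing {L : FirstOrder.Language.{0, 0}} (A : Modeling.{u} L) {k : ℕ}
    (φ : L.Formula (Fin k)) : ℝ :=
  (Measure.pi fun _ : Fin k => A.ν).real {x : Fin k → A.carrier | φ.Realize x}

/-- The underlying structure of the modeling is a (finite or infinite) matroid: `I_k` consists of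
the independent `k`-tuples of some matroid on the whole domain. -/
def Modeling.IsMatroid (A : Modeling.{u} matroidLanguage) : Prop :=
  ∃ N : Matroid A.carrier, N.E = Set.univ ∧
    ∀ (k : ℕ) (x : Fin (k + 1) → A.carrier),
      FirstOrder.Language.Structure.RelMap (L := matroidLanguage) (IndepSymbol.indep k) x ↔
        IndepTuple N x

/-- A limit modeling of a sequence of finite matroids. -/
def IsLimitModeling {α : Type v} (A : Modeling.{u} matroidLanguage) (M : ℕ → Matroid α) : Prop :=
  A.IsMatroid ∧ ∀ (k : ℕ) (φ : matroidLanguage.Formula (Fin k)),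
    Tendsto (fun n => finitePairing (M n) φ) atTop (𝓝 (A.pairing φ))

end FOMatroid

/-!
A bounded measurable kernel on a product of probability spaces whose signed count of 4-cycles is
zero vanishes almost everywhere: almost all codegrees are then zero, and hence so are almost all
column integrals over any measurable set of rows, by two applications of
`∫ (∫ K (x, z) dz) ^ 2 dx = 0`. So for a measurable relation, whose kernel takes the values `±1`,
the density of the 4-cycles with an even number of edges is never exactly `1/2`.

This density nevertheless tends to `1/2` along finite graphs definable in binary matroids. For a
quadratic form `Q` over `𝔽₂` with nondegenerate polar form, the points of the quadric `Q = 1` form a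
matroid without loops or parallel elements, and distinct points `x`, `y` lie in a dependent triple
exactly when `Q (x + y) = 1`, that is, when `polar Q x y = 1`. This graph is quasirandom because the
Gauss sum of `Q` on a space of `N` vectors has absolute value `√N`.
-/

namespace FOMatroid

open MeasureTheory Filter Topology

section FourCycle

theorem ae_eq_zero_of_forall_setIntegral_prod_eq_zero {α β E : Type*}
    [MeasurableSpace α] [MeasurableSpace β] [NormedAddCommGroup E] [NormedSpace ℝ E]
    [CompleteSpace E] {μ : Measure α} {ν : Measure β} {f : α × β → E}
    (hf : Integrable f (μ.prod ν))
    (hrect : ∀ U W, MeasurableSet U → MeasurableSet W → ∫ p in U ×ˢ W, f p ∂(μ.prod ν) = 0) :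
    f =ᵐ[μ.prod ν] 0 := by
  suffices h : ∀ S, MeasurableSet S → ∫ p in S, f p ∂(μ.prod ν) = 0 from
    hf.ae_eq_zero_of_forall_setIntegral_eq_zero fun S hS _ => h S hS
  intro S hS
  induction S, hS using MeasurableSpace.induction_on_inter generateFrom_prod.symm
    isPiSystem_prod with
  | empty => exact setIntegral_empty
  | basic S hS =>
    obtain ⟨U, hU, W, hW, rfl⟩ := hS
    exact hrect U W hU hW
  | compl S hS ih =>
    have huniv := hrect Set.univ Set.univ .univ .univ
    rw [Set.univ_prod_univ, setIntegral_univ] at huniv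
    rw [setIntegral_compl hS hf, huniv, ih, sub_zero]
  | iUnion S hdisj hS ih =>
    rw [integral_iUnion hS hdisj hf.integrableOn]
    simp only [ih, tsum_zero]

variable {α β : Type*}

/-- The product of a kernel `H` over the four edges of the 4-cycle with parts `w.1` and `w.2`. -/
def fourCycle (H : α × β → ℝ) (w : (α × α) × (β × β)) : ℝ :=
  (H (w.1.1, w.2.1) * H (w.1.2, w.2.1)) * (H (w.1.1, w.2.2) * H (w.1.2, w.2.2))

variable [MeasurableSpace α] [MeasurableSpace β] {μ : Measure α} {ν : Measure β}

-- Duplicating the integration variable turns the hypothesis into `∫ (∫ K (x, z) dz) ^ 2 dx = 0`.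
theorem ae_integral_eq_zero_of_integral_mul_eq_zero [SFinite μ] [SFinite ν] {K : α × β → ℝ}
    (hK : Integrable (fun w : α × (β × β) => K (w.1, w.2.1) * K (w.1, w.2.2)) (μ.prod (ν.prod ν)))
    (h0 : ∫ w : α × (β × β), K (w.1, w.2.1) * K (w.1, w.2.2) ∂(μ.prod (ν.prod ν)) = 0) :
    ∀ᵐ x ∂μ, ∫ z, K (x, z) ∂ν = 0 := by
  have hsq : ∀ x, ∫ q : β × β, K (x, q.1) * K (x, q.2) ∂(ν.prod ν) = (∫ z, K (x, z) ∂ν) ^ 2 :=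
    fun x => by rw [sq, ← integral_prod_mul]
  have hint : Integrable (fun x => (∫ z, K (x, z) ∂ν) ^ 2) μ := by
    simpa only [hsq] using hK.integral_prod_left
  rw [integral_prod _ hK] at h0
  simp only [hsq] at h0
  filter_upwards [(integral_eq_zero_iff_of_nonneg (fun _ => sq_nonneg _) hint).1 h0] with x hx
  exact pow_eq_zero_iff two_ne_zero |>.1 hx

variable [IsFiniteMeasure μ] [IsFiniteMeasure ν] {H : α × β → ℝ} {C : ℝ}

theorem integrable_mul_of_bounded (hH : AEStronglyMeasurable H (μ.prod ν)) (hC : ∀ p, |H p| ≤ C) :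
    Integrable (fun w : α × (β × β) => H (w.1, w.2.1) * H (w.1, w.2.2)) (μ.prod (ν.prod ν)) := by
  refine .of_bound (.mul ?_ ?_) (C * C) (.of_forall fun w => ?_)
  · exact hH.comp_quasiMeasurePreserving
      (QuasiMeasurePreserving.prodMap (.id μ) Measure.quasiMeasurePreserving_fst)
  · exact hH.comp_quasiMeasurePreserving
      (QuasiMeasurePreserving.prodMap (.id μ) Measure.quasiMeasurePreserving_snd)
  · rw [Real.norm_eq_abs, abs_mul]
    exact mul_le_mul (hC _) (hC _) (abs_nonneg _) ((abs_nonneg _).trans (hC (w.1, w.2.1)))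

theorem integrable_codegree (hH : AEStronglyMeasurable H (μ.prod ν)) (hC : ∀ p, |H p| ≤ C) :
    Integrable (fun q : (α × α) × β => H (q.1.1, q.2) * H (q.1.2, q.2)) ((μ.prod μ).prod ν) :=
  (integrable_mul_of_bounded (H := H ∘ Prod.swap) hH.prod_swap fun _ => hC _).swap

theorem integrable_fourCycle (hH : AEStronglyMeasurable H (μ.prod ν)) (hC : ∀ p, |H p| ≤ C) :
    Integrable (fourCycle H) ((μ.prod μ).prod (ν.prod ν)) := by
  refine integrable_mul_of_bounded (integrable_codegree hH hC).aestronglyMeasurable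
    (C := C * C) fun q => ?_
  rw [abs_mul]
  exact mul_le_mul (hC _) (hC _) (abs_nonneg _) ((abs_nonneg _).trans (hC (q.1.1, q.2)))

theorem ae_integral_eq_zero_of_codegree_eq_zero (hH : AEStronglyMeasurable H (μ.prod ν))
    (hC : ∀ p, |H p| ≤ C)
    (hdeg : ∀ᵐ p ∂(μ.prod μ), ∫ z, H (p.1, z) * H (p.2, z) ∂ν = 0) :
    ∀ᵐ z ∂ν, ∫ x, H (x, z) ∂μ = 0 := by
  have hint := integrable_codegree hH hC
  refine ae_integral_eq_zero_of_integral_mul_eq_zero (K := H ∘ Prod.swap) hint.swap ?_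
  refine (integral_prod_swap fun q : (α × α) × β => H (q.1.1, q.2) * H (q.1.2, q.2)).trans ?_
  rw [integral_prod _ hint]
  exact integral_eq_zero_of_ae hdeg

theorem ae_eq_zero_of_integral_fourCycle_eq_zero (hH : AEStronglyMeasurable H (μ.prod ν))
    (hC : ∀ p, |H p| ≤ C)
    (h0 : ∫ w, fourCycle H w ∂((μ.prod μ).prod (ν.prod ν)) = 0) :
    H =ᵐ[μ.prod ν] 0 := by
  have hint : Integrable H (μ.prod ν) := .of_bound hH C (.of_forall hC)
  have hdeg : ∀ᵐ p ∂(μ.prod μ), ∫ z, H (p.1, z) * H (p.2, z) ∂ν = 0 :=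
    ae_integral_eq_zero_of_integral_mul_eq_zero
      (K := fun q : (α × α) × β => H (q.1.1, q.2) * H (q.1.2, q.2)) (integrable_fourCycle hH hC) h0
  refine ae_eq_zero_of_forall_setIntegral_prod_eq_zero hint fun U W _ _ => ?_
  have hUH : AEStronglyMeasurable H ((μ.restrict U).prod ν) := by
    have := hH.restrict (s := U ×ˢ Set.univ)
    rwa [← Measure.prod_restrict, Measure.restrict_univ] at this
  have hUdeg : ∀ᵐ p ∂((μ.restrict U).prod (μ.restrict U)),
      ∫ z, H (p.1, z) * H (p.2, z) ∂ν = 0 := by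
    rw [Measure.prod_restrict]
    exact ae_restrict_of_ae hdeg
  have hcol : ∀ᵐ z ∂ν, ∫ x in U, H (x, z) ∂μ = 0 :=
    ae_integral_eq_zero_of_codegree_eq_zero hUH hC hUdeg
  rw [← Measure.prod_restrict, integral_prod_symm]
  · exact integral_eq_zero_of_ae (ae_restrict_of_ae hcol)
  · rw [Measure.prod_restrict]
    exact hint.restrict

end FourCycle

section RelSign

variable {α β : Type*} {R : α → β → Prop}

open Classical in
/-- The kernel of a relation: `1` on related pairs and `-1` on all others. -/
noncomputable def relSign (R : α → β → Prop) (p : α × β) : ℝ := if R p.1 p.2 then 1 else -1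

/-- The 4-cycle with parts `p` and `q` contains an even number of edges of the bipartite
graph `R`. -/
def EvenFourCycle (R : α → β → Prop) (p : α × α) (q : β × β) : Prop :=
  (R p.1 q.1 ↔ R p.2 q.1) ↔ (R p.1 q.2 ↔ R p.2 q.2)

theorem abs_relSign (p : α × β) : |relSign R p| = 1 := by
  unfold relSign
  split_ifs <;> simp

theorem relSign_eq_indicator :
    relSign R = fun p => {p | R p.1 p.2}.indicator (fun _ => (2 : ℝ)) p - 1 := by
  funext p
  by_cases h : R p.1 p.2
  · simp only [relSign, h, if_true, Set.indicator, Set.mem_ofPred_eq]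
    norm_num
  · simp [relSign, h]

theorem fourCycle_relSign : fourCycle (relSign R) = relSign (EvenFourCycle R) := by
  funext ⟨⟨a, b⟩, c, d⟩
  by_cases hac : R a c <;> by_cases hbc : R b c <;> by_cases had : R a d <;>
    by_cases hbd : R b d <;> simp [fourCycle, relSign, EvenFourCycle, hac, hbc, had, hbd]

section Finite

variable [Fintype α] [Fintype β]

theorem sum_relSign :
    ∑ p, relSign R p =
      2 * Nat.card {p : α × β // R p.1 p.2} - Fintype.card α * Fintype.card β := by
  classical
  have hterm : ∀ p, relSign R p = 2 * (if R p.1 p.2 then 1 else 0) - 1 := fun p => by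
    unfold relSign
    split_ifs <;> norm_num
  simp only [hterm, Finset.sum_sub_distrib, ← Finset.mul_sum, Finset.sum_boole, Finset.sum_const,
    Finset.card_univ, Fintype.card_prod, Nat.card_eq_fintype_card, Fintype.card_subtype,
    nsmul_eq_mul, Nat.cast_mul, mul_one]

theorem sum_fourCycle (H : α × β → ℝ) :
    ∑ w, fourCycle H w = ∑ p : α × α, (∑ z, H (p.1, z) * H (p.2, z)) ^ 2 := by
  simp only [Fintype.sum_prod_type, fourCycle, sq, Finset.sum_mul_sum]

theorem sum_fourCycle_le {H : α × β → ℝ} {c : ℝ} (hc : 0 ≤ c) (hH : ∀ p, |H p| ≤ 1)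
    (hdeg : ∀ x y, x ≠ y → (∑ z, H (x, z) * H (y, z)) ^ 2 ≤ c) :
    ∑ w, fourCycle H w ≤
      Fintype.card α * (Fintype.card β : ℝ) ^ 2 + (Fintype.card α : ℝ) ^ 2 * c := by
  classical
  have hbound : ∀ x y, |∑ z, H (x, z) * H (y, z)| ≤ Fintype.card β := fun x y =>
    calc |∑ z, H (x, z) * H (y, z)| ≤ ∑ z, |H (x, z) * H (y, z)| := Finset.abs_sum_le_sum_abs _ _
      _ ≤ ∑ _z : β, (1 : ℝ) := by
        gcongr with z
        rw [abs_mul]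
        exact mul_le_one₀ (hH _) (abs_nonneg _) (hH _)
      _ = Fintype.card β := by simp
  have hterm : ∀ x y, (∑ z, H (x, z) * H (y, z)) ^ 2 ≤
      (if x = y then (Fintype.card β : ℝ) ^ 2 else 0) + c := fun x y => by
    split_ifs with hxy
    · exact le_add_of_le_of_nonneg (sq_le_sq.2 ((hbound x y).trans (le_abs_self _))) hc
    · simpa only [zero_add] using hdeg x y hxy
  rw [sum_fourCycle, Fintype.sum_prod_type]
  refine (Finset.sum_le_sum fun x _ => Finset.sum_le_sum fun y _ => hterm x y).trans_eq ?_
  simp only [Finset.sum_add_distrib, Finset.sum_ite_eq, Finset.mem_univ, if_true, Finset.sum_const,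
    Finset.card_univ, nsmul_eq_mul]
  ring

end Finite

theorem abs_two_mul_density_evenFourCycle_sub_one_le [Fintype α] [Nonempty α] {R : α → α → Prop}
    (hdeg : ∀ x y, x ≠ y → (∑ z, relSign R (x, z) * relSign R (y, z)) ^ 2 ≤ Fintype.card α) :
    |2 * ((Nat.card {w : (α × α) × (α × α) // EvenFourCycle R w.1 w.2} : ℝ) /
        (Fintype.card α : ℝ) ^ 4) - 1| ≤ 2 / (Fintype.card α : ℝ) := by
  set N : ℝ := (Fintype.card α : ℝ)
  have hpos : 0 < N := Nat.cast_pos.2 Fintype.card_pos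
  have hsum : ∑ w, fourCycle (relSign R) w =
      2 * Nat.card {w : (α × α) × (α × α) // EvenFourCycle R w.1 w.2} - N ^ 4 := by
    rw [fourCycle_relSign, sum_relSign, Fintype.card_prod]
    push_cast
    ring
  have hnonneg : 0 ≤ ∑ w, fourCycle (relSign R) w := by
    rw [sum_fourCycle]
    positivity
  have hle : ∑ w, fourCycle (relSign R) w ≤ N * N ^ 2 + N ^ 2 * N :=
    sum_fourCycle_le hpos.le (fun p => (abs_relSign p).le) hdeg
  have hdensity : 2 * (Nat.card {w : (α × α) × (α × α) // EvenFourCycle R w.1 w.2} / N ^ 4) - 1 =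
      (∑ w, fourCycle (relSign R) w) / N ^ 4 := by
    rw [hsum]
    field_simp
  rw [hdensity, abs_of_nonneg (by positivity)]
  calc (∑ w, fourCycle (relSign R) w) / N ^ 4 ≤ (N * N ^ 2 + N ^ 2 * N) / N ^ 4 := by gcongr
    _ = 2 / N := by
      field_simp
      norm_num

section Measure

variable [MeasurableSpace α] [MeasurableSpace β] {μ : Measure α} {ν : Measure β}

theorem aestronglyMeasurable_relSign (hR : NullMeasurableSet {p | R p.1 p.2} (μ.prod ν)) :
    AEStronglyMeasurable (relSign R) (μ.prod ν) := by
  rw [relSign_eq_indicator]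
  exact (aestronglyMeasurable_const.indicator₀ hR).sub aestronglyMeasurable_const

theorem nullMeasurableSet_of_relSign (hR : AEStronglyMeasurable (relSign R) (μ.prod ν)) :
    NullMeasurableSet {p | R p.1 p.2} (μ.prod ν) := by
  have h : {p | R p.1 p.2} = relSign R ⁻¹' {1} := by
    ext p
    by_cases hp : R p.1 p.2
    · simp [relSign, hp]
    · simp only [relSign, hp, Set.mem_ofPred_eq, if_false, Set.mem_preimage, Set.mem_singleton_iff]
      norm_num
  rw [h]
  exact hR.aemeasurable.nullMeasurable (measurableSet_singleton 1)

variable [IsProbabilityMeasure μ] [IsProbabilityMeasure ν]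

theorem integral_relSign (hR : NullMeasurableSet {p | R p.1 p.2} (μ.prod ν)) :
    ∫ p, relSign R p ∂(μ.prod ν) = 2 * (μ.prod ν).real {p | R p.1 p.2} - 1 := by
  have hint : Integrable ({p : α × β | R p.1 p.2}.indicator fun _ => (2 : ℝ)) (μ.prod ν) :=
    (integrable_const 2).indicator₀ hR
  rw [relSign_eq_indicator, integral_sub hint (integrable_const 1), integral_indicator₀ hR,
    setIntegral_const, integral_const, probReal_univ, smul_eq_mul, one_smul, mul_comm]

theorem nullMeasurableSet_evenFourCycle (hR : NullMeasurableSet {p | R p.1 p.2} (μ.prod ν)) :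
    NullMeasurableSet {w : (α × α) × (β × β) | EvenFourCycle R w.1 w.2}
      ((μ.prod μ).prod (ν.prod ν)) := by
  refine nullMeasurableSet_of_relSign ?_
  rw [← fourCycle_relSign]
  exact (integrable_fourCycle (aestronglyMeasurable_relSign hR) fun p =>
    (abs_relSign p).le).aestronglyMeasurable

theorem measureReal_evenFourCycle_ne_one_half (hR : NullMeasurableSet {p | R p.1 p.2} (μ.prod ν)) :
    ((μ.prod μ).prod (ν.prod ν)).real {w | EvenFourCycle R w.1 w.2} ≠ 1 / 2 := by
  intro h
  have hzero : relSign R =ᵐ[μ.prod ν] 0 := by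
    refine ae_eq_zero_of_integral_fourCycle_eq_zero (aestronglyMeasurable_relSign hR)
      (fun p => (abs_relSign p).le) ?_
    rw [fourCycle_relSign, integral_relSign (nullMeasurableSet_evenFourCycle hR), h]
    norm_num
  obtain ⟨p, hp⟩ := hzero.exists
  have hone := abs_relSign (R := R) p
  rw [hp, Pi.zero_apply, abs_zero] at hone
  exact zero_ne_one hone

end Measure

end RelSign

section Quadric

open QuadraticMap

/-- The nontrivial character of the additive group of the two-element field. -/
noncomputable def signChar : AddChar (ZMod 2) ℝ := AddChar.zmodChar 2 (neg_one_sq)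

theorem signChar_apply (t : ZMod 2) : signChar t = if t = 1 then -1 else 1 := by
  have h01 : t = 0 ∨ t = 1 := by decide +revert
  rcases h01 with rfl | rfl <;> simp [signChar, AddChar.zmodChar_apply, ZMod.val_one]

theorem polarBilin_dualProd {R M : Type*} [CommRing R] [AddCommGroup M] [Module R M] :
    (QuadraticForm.dualProd R M).polarBilin = LinearMap.dualProd R M := by
  ext <;> simp [polar]

theorem separatingLeft_polarBilin_dualProd (R M : Type*) [CommRing R] [AddCommGroup M] [Module R M]
    [Module.Free R M] : (QuadraticForm.dualProd R M).polarBilin.SeparatingLeft := by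
  rw [polarBilin_dualProd, LinearMap.separatingLeft_dualProd]
  exact (Module.Free.chooseBasis R M).eval_injective

variable {W : Type*} [AddCommGroup W]

theorem sum_signChar_addMonoidHom [Fintype W] {f : W →+ ZMod 2} (hf : f ≠ 0) :
    ∑ z, signChar (f z) = 0 := by
  suffices h : signChar.compAddMonoidHom f ≠ 0 from AddChar.sum_eq_zero_iff_ne_zero.2 h
  intro h
  refine hf (DFunLike.ext _ _ fun z => ?_)
  have hz : signChar (f z) = 1 := DFunLike.congr_fun h z
  rw [signChar_apply] at hz
  split_ifs at hz with h1
  · norm_num at hz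
  · exact (by decide : ∀ t : ZMod 2, t ≠ 1 → t = 0) _ h1

variable [Module (ZMod 2) W] (Q : QuadraticForm (ZMod 2) W)

/-- The vectors at which a quadratic form over the two-element field takes the value `1`. -/
def quadric : Set W := {z | Q z = 1}

/-- Adjacency of points of a quadric: the vectors are not orthogonal for the polar form. -/
def QuadricAdj (x y : quadric Q) : Prop := polar Q (x : W) y = 1

variable {Q}

theorem relSign_quadricAdj_mul (x y z : quadric Q) :
    relSign (QuadricAdj Q) (x, z) * relSign (QuadricAdj Q) (y, z) =
      signChar (polar Q (x + y : W) z) := by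
  have hsign : ∀ a b : quadric Q, relSign (QuadricAdj Q) (a, b) = - signChar (polar Q (a : W) b) :=
    fun a b => by
      rw [signChar_apply, relSign, QuadricAdj]
      split_ifs <;> norm_num
  rw [hsign, hsign, neg_mul_neg, polar_add_left, AddChar.map_add_eq_mul]

instance : DecidablePred (· ∈ quadric Q) := fun z => decEq (Q z) 1

variable [Fintype W]

theorem two_mul_sum_quadric (f : W → ℝ) :
    2 * ∑ z : quadric Q, f z = ∑ z, f z - ∑ z, signChar (Q z) * f z := by
  have hterm : ∀ z, f z - signChar (Q z) * f z = 2 * (if Q z = 1 then f z else 0) := fun z => by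
    rw [signChar_apply]
    split_ifs <;> ring
  have hsubtype : ∑ z : quadric Q, f z = ∑ z with Q z = 1, f z :=
    (Finset.sum_subtype _ (fun z => Finset.mem_filter_univ z) f).symm
  rw [← Finset.sum_sub_distrib, Finset.sum_congr rfl fun z _ => hterm z, ← Finset.mul_sum,
    ← Finset.sum_filter, hsubtype]

variable (Q) in
/-- The Gauss sum of a quadratic form over the two-element field. -/
noncomputable def quadraticGaussSum : ℝ := ∑ z, signChar (Q z)

theorem sum_signChar_mul_signChar_polar (u : W) :
    ∑ z, signChar (Q z) * signChar (polar Q u z) = signChar (Q u) * quadraticGaussSum Q := by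
  have hshift : quadraticGaussSum Q = ∑ z, signChar (Q (u + z)) :=
    (Equiv.sum_comp (Equiv.addLeft u) fun z => signChar (Q z)).symm
  rw [hshift, Finset.mul_sum]
  refine Finset.sum_congr rfl fun z _ => ?_
  rw [← AddChar.map_add_eq_mul, ← AddChar.map_add_eq_mul, QuadraticMap.map_add Q, add_assoc (Q u),
    ← add_assoc (Q u) (Q u), CharTwo.add_self_eq_zero, zero_add]

theorem sum_signChar_polar (hQ : Q.polarBilin.SeparatingLeft) {u : W} (hu : u ≠ 0) :
    ∑ z, signChar (polar Q u z) = 0 :=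
  sum_signChar_addMonoidHom (f := (Q.polarBilin u).toAddMonoidHom) fun h =>
    hu (hQ u fun z => DFunLike.congr_fun h z)

theorem sq_quadraticGaussSum (hQ : Q.polarBilin.SeparatingLeft) :
    quadraticGaussSum Q ^ 2 = Fintype.card W := by
  classical
  calc quadraticGaussSum Q ^ 2
      = ∑ u, ∑ z, signChar (Q z) * signChar (polar Q z u) := by
        simp only [polar_comm Q _ _, sum_signChar_mul_signChar_polar, ← Finset.sum_mul]
        exact pow_two _
    _ = ∑ z, signChar (Q z) * ∑ u, signChar (polar Q z u) := by
        rw [Finset.sum_comm]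
        simp only [Finset.mul_sum]
    _ = signChar (Q 0) * ∑ u, signChar (polar Q 0 u) :=
        Fintype.sum_eq_single 0 fun z hz => by rw [sum_signChar_polar hQ hz, mul_zero]
    _ = Fintype.card W := by simp

theorem card_le_four_mul_card_quadric (hQ : Q.polarBilin.SeparatingLeft)
    (hW : 4 ≤ Fintype.card W) : (Fintype.card W : ℝ) ≤ 4 * Fintype.card (quadric Q) := by
  have hcard := two_mul_sum_quadric (Q := Q) fun _ => 1
  simp only [Finset.sum_const, Finset.card_univ, nsmul_eq_mul, mul_one] at hcard
  have hgauss : quadraticGaussSum Q ≤ Fintype.card W / 2 := by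
    have hW' : (4 : ℝ) ≤ Fintype.card W := by exact_mod_cast hW
    nlinarith [sq_quadraticGaussSum hQ]
  rw [quadraticGaussSum] at hgauss
  linarith

theorem sq_sum_quadric_signChar_polar (hQ : Q.polarBilin.SeparatingLeft) {u : W} (hu : u ≠ 0) :
    (∑ z : quadric Q, signChar (polar Q u z)) ^ 2 = Fintype.card W / 4 := by
  have hsum := two_mul_sum_quadric (Q := Q) fun z => signChar (polar Q u z)
  rw [sum_signChar_polar hQ hu, sum_signChar_mul_signChar_polar, zero_sub] at hsum
  have hsq : signChar (Q u) ^ 2 = 1 := by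
    rw [signChar_apply]
    split_ifs <;> norm_num
  calc (∑ z : quadric Q, signChar (polar Q u z)) ^ 2
      = signChar (Q u) ^ 2 * quadraticGaussSum Q ^ 2 / 4 := by
        linear_combination (2 * (∑ z : quadric Q, signChar (polar Q u z)) -
          signChar (Q u) * quadraticGaussSum Q) / 4 * hsum
    _ = (Fintype.card W : ℝ) / 4 := by rw [hsq, sq_quadraticGaussSum hQ, one_mul]

theorem nonempty_quadric (hQ : Q.polarBilin.SeparatingLeft) (hW : 4 ≤ Fintype.card W) :
    (quadric Q).Nonempty := by
  have hle := card_le_four_mul_card_quadric hQ hW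
  rw [← Set.nonempty_coe_sort, ← Fintype.card_pos_iff]
  rify
  rify at hW
  linarith

theorem abs_two_mul_density_evenFourCycle_quadricAdj_sub_one_le (hQ : Q.polarBilin.SeparatingLeft)
    (hW : 4 ≤ Fintype.card W) :
    |2 * ((Nat.card {w : (quadric Q × quadric Q) × (quadric Q × quadric Q) //
        EvenFourCycle (QuadricAdj Q) w.1 w.2} : ℝ) / (Fintype.card (quadric Q) : ℝ) ^ 4) - 1| ≤
      8 / (Fintype.card W : ℝ) := by
  have hle := card_le_four_mul_card_quadric hQ hW
  have hpos : (0 : ℝ) < Fintype.card W := by positivity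
  have : Nonempty (quadric Q) := (nonempty_quadric hQ hW).to_subtype
  refine (abs_two_mul_density_evenFourCycle_sub_one_le fun x y hxy => ?_).trans ?_
  · have hadd : (x + y : W) ≠ 0 := fun h =>
      hxy (Subtype.ext ((add_eq_zero_iff_eq_neg.1 h).trans (ZModModule.neg_eq_self _)))
    simp only [relSign_quadricAdj_mul]
    rw [sq_sum_quadric_signChar_polar hQ hadd]
    linarith
  · rw [div_le_div_iff₀ (by positivity) hpos]
    linarith

end Quadric

section LinearMatroid

variable {F V α : Type*} [Field F] [AddCommGroup V] [Module F V]

theorem exists_linearIndepOn_insert {f : α → V} {I J : Set α} (hI : LinearIndepOn F f I)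
    (hIfin : I.Finite) (hJ : LinearIndepOn F f J) (hJfin : J.Finite) (hcard : I.ncard < J.ncard) :
    ∃ e ∈ J, e ∉ I ∧ LinearIndepOn F f (insert e I) := by
  by_contra! hcon
  have hspan : ∀ e ∈ J, f e ∈ Submodule.span F (f '' I) := by
    intro e he
    by_cases heI : e ∈ I
    · exact Submodule.subset_span ⟨e, heI, rfl⟩
    · by_contra hnot
      exact hcon e he heI ((linearIndepOn_insert heI).2 ⟨hI, hnot⟩)
  have := hJfin.fintype
  have := (hIfin.image f).fintype
  have hle := linearIndependent_le_span_aux' (R := F) (fun x : J => f x) hJ (f '' I)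
    (by rintro _ ⟨x, rfl⟩; exact hspan x x.2)
  rw [← Nat.card_eq_fintype_card, ← Nat.card_eq_fintype_card, Nat.card_coe_set_eq,
    Nat.card_coe_set_eq] at hle
  exact (hle.trans (Set.ncard_image_le hIfin)).not_gt hcard

variable (F) in
/-- The linear matroid of a family of vectors, restricted to a finite set `E` of indices. -/
def linearMatroid {E : Set α} (hE : E.Finite) (f : α → V) : Matroid α :=
  (IndepMatroid.ofFinite hE (fun I => I ⊆ E ∧ LinearIndepOn F f I)
    ⟨Set.empty_subset _, linearIndepOn_empty F f⟩
    (fun _ _ hJ hIJ => ⟨hIJ.trans hJ.1, hJ.2.mono hIJ⟩)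
    (fun _ _ hI hJ hIJ => by
      obtain ⟨e, heJ, heI, h⟩ := exists_linearIndepOn_insert hI.2 (hE.subset hI.1) hJ.2
        (hE.subset hJ.1) hIJ
      exact ⟨e, heJ, heI, Set.insert_subset (hJ.1 heJ) hI.1, h⟩)
    (fun _ hI => hI.1)).matroid

variable {E : Set α} {hE : E.Finite} {f : α → V}

theorem linearMatroid_indep_iff {I : Set α} :
    (linearMatroid F hE f).Indep I ↔ I ⊆ E ∧ LinearIndepOn F f I := by
  simp [linearMatroid, IndepMatroid.ofFinite, IndepMatroid.ofBddAugment, IndepMatroid.ofBdd]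

theorem isRepresentable_linearMatroid [FiniteDimensional F V] :
    IsRepresentable F (linearMatroid F hE f) := by
  let φ := (Module.finBasis F V).equivFun
  refine ⟨Module.finrank F V, φ ∘ f, fun I hI => ?_⟩
  rw [linearMatroid_indep_iff, and_iff_right (show I ⊆ E from hI)]
  exact (φ.toLinearMap.linearIndependent_iff φ.ker).symm

theorem indepTuple_linearMatroid_iff {k : ℕ} {x : Fin k → α} (hx : ∀ i, x i ∈ E) :
    IndepTuple (linearMatroid F hE f) x ↔ LinearIndependent F fun i => f (x i) := by
  have hrange : Set.range x ⊆ E := Set.range_subset_iff.2 hx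
  rw [IndepTuple, linearMatroid_indep_iff, and_iff_right hrange]
  constructor
  · rintro ⟨hinj, h⟩
    exact (linearIndepOn_range_iff hinj f).1 h
  · intro h
    have hinj : Function.Injective x := .of_comp (f := f) h.injective
    exact ⟨hinj, (linearIndepOn_range_iff hinj f).2 h⟩

end LinearMatroid

section MapEmbedding

open scoped FirstOrder

variable {α β : Type*} (M : Matroid α) (g : α ↪ β)

variable {M} in
theorem IsRepresentable.mapEmbedding {F : Type*} [Field F] (hM : IsRepresentable F M) :
    IsRepresentable F (M.mapEmbedding g) := by
  obtain ⟨r, f, hf⟩ := hM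
  refine ⟨r, Function.extend g f 0, fun J hJ => ?_⟩
  obtain ⟨I, hI, rfl⟩ := Set.subset_image_iff.1 hJ
  rw [Matroid.mapEmbedding_indep_iff, Set.preimage_image_eq _ g.injective,
    and_iff_left (Set.image_subset_range _ _), hf I hI]
  have hext : Function.extend g f 0 ∘ g = f := Function.extend_comp g.injective f 0
  constructor
  · intro h
    exact .image_of_comp g _ (hext.symm ▸ h)
  · intro h
    exact hext ▸ h.comp_of_image g.injective.injOn

theorem indepTuple_mapEmbedding_iff {k : ℕ} (x : Fin k → α) :
    IndepTuple (M.mapEmbedding g) (g ∘ x) ↔ IndepTuple M x := by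
  rw [IndepTuple, IndepTuple, g.injective.of_comp_iff, Matroid.mapEmbedding_indep_iff,
    Set.range_comp, Set.preimage_image_eq _ g.injective,
    and_iff_left (Set.image_subset_range _ _)]

/-- An embedding of a matroid is an isomorphism of the associated structures. -/
noncomputable def groundEquiv :
    letI := groundStructure M
    letI := groundStructure (M.mapEmbedding g)
    M.E ≃[matroidLanguage] (M.mapEmbedding g).E :=
  letI := groundStructure M
  letI := groundStructure (M.mapEmbedding g)
  { Equiv.Set.image g M.E g.injective with
    map_fun' := fun f => nomatch f
    map_rel' := by
      rintro _ ⟨k⟩ x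
      exact indepTuple_mapEmbedding_iff M g fun i => (x i : α) }

theorem finitePairing_mapEmbedding {k : ℕ} (φ : matroidLanguage.Formula (Fin k)) :
    finitePairing (M.mapEmbedding g) φ = finitePairing M φ := by
  let := groundStructure M
  let := groundStructure (M.mapEmbedding g)
  let e := groundEquiv M g
  have hsat : {x : Fin k → M.E // φ.Realize x} ≃
      {x : Fin k → (M.mapEmbedding g).E // φ.Realize x} :=
    (Equiv.arrowCongr (.refl _) e.toEquiv).subtypeEquiv fun x =>
      (FirstOrder.Language.StrongHomClass.realize_formula e φ).symm
  rw [finitePairing, finitePairing, Nat.card_congr hsat, Nat.card_congr e.toEquiv]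

end MapEmbedding

section Formulas

open FirstOrder FirstOrder.Language

section Line

variable {L : Language} {A : Type*} [L.Structure A]

/-- `x` and `y` are distinct, and together with a third element they form a triple outside the
relation `R`. -/
def lineFormula (R : L.Relations 3) : L.Formula (Fin 2) :=
  letI x : L.Term (Fin 2 ⊕ Fin 1) := Term.var (Sum.inl 0)
  letI y : L.Term (Fin 2 ⊕ Fin 1) := Term.var (Sum.inl 1)
  letI z : L.Term (Fin 2 ⊕ Fin 1) := Term.var (Sum.inr 0)
  ((x.bdEqual y).not ⊓ (x.bdEqual z).not ⊓ (y.bdEqual z).not ⊓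
    (R.boundedFormula ![x, y, z]).not).ex

theorem realize_lineFormula (R : L.Relations 3) (x y : A) :
    (lineFormula R).Realize ![x, y] ↔
      ∃ z, x ≠ y ∧ x ≠ z ∧ y ≠ z ∧ ¬ Structure.RelMap R ![x, y, z] := by
  simp only [lineFormula, Formula.Realize, BoundedFormula.realize_ex, BoundedFormula.realize_inf,
    BoundedFormula.realize_not, BoundedFormula.realize_bdEqual, BoundedFormula.realize_rel,
    Term.realize_var, Sum.elim_inl, Sum.elim_inr, and_assoc]
  refine exists_congr fun z => ?_
  have hz : Fin.snoc (α := fun _ => A) (default : Fin 0 → A) z 0 = z := by simp [Fin.snoc]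
  have htriple : (fun i => Term.realize (Sum.elim ![x, y] (Fin.snoc default z))
      ((![Term.var (Sum.inl 0), Term.var (Sum.inl 1), Term.var (Sum.inr 0)] :
        Fin 3 → L.Term (Fin 2 ⊕ Fin 1)) i)) = ![x, y, z] := by
    funext i
    fin_cases i <;> simp [hz]
  rw [htriple, hz]
  rfl

end Line

variable {A : Type*} [matroidLanguage.Structure A]

/-- `x` and `y` are distinct and form a dependent triple with a third element. -/
def adjFormula : matroidLanguage.Formula (Fin 2) :=
  lineFormula (L := matroidLanguage) (IndepSymbol.indep 2)

/-- The 4-cycle with parts `{x₀, x₁}` and `{x₂, x₃}` has an even number of edges in the graph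
defined by `adjFormula`. -/
def evenCycleFormula : matroidLanguage.Formula (Fin 4) :=
  ((adjFormula.relabel ![0, 2]).iff (adjFormula.relabel ![1, 2])).iff
    ((adjFormula.relabel ![0, 3]).iff (adjFormula.relabel ![1, 3]))

theorem realize_evenCycleFormula (x : Fin 4 → A) :
    evenCycleFormula.Realize x ↔
      EvenFourCycle (fun a b : A => adjFormula.Realize ![a, b]) (x 0, x 1) (x 2, x 3) := by
  have hcomp : ∀ i j, x ∘ ![i, j] = ![x i, x j] := fun i j => by
    funext k
    fin_cases k <;> rfl
  simp only [evenCycleFormula, EvenFourCycle, Formula.realize_iff, Formula.realize_relabel, hcomp]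

end Formulas

section EvenCyclePairing

variable {α : Type*}

theorem finitePairing_evenCycleFormula (M : Matroid α) :
    letI := groundStructure M
    finitePairing M evenCycleFormula =
      Nat.card {w : (M.E × M.E) × (M.E × M.E) //
        EvenFourCycle (fun a b : M.E => adjFormula.Realize ![a, b]) w.1 w.2} /
          (Nat.card M.E : ℝ) ^ 4 := by
  let := groundStructure M
  let pairs : (Fin 4 → M.E) ≃ (M.E × M.E) × (M.E × M.E) :=
    { toFun := fun x => ((x 0, x 1), (x 2, x 3))
      invFun := fun w => ![w.1.1, w.1.2, w.2.1, w.2.2]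
      left_inv := fun x => by
        funext i
        fin_cases i <;> rfl
      right_inv := fun _ => rfl }
  have hsat : {x : Fin 4 → M.E // evenCycleFormula.Realize x} ≃
      {w : (M.E × M.E) × (M.E × M.E) //
        EvenFourCycle (fun a b : M.E => adjFormula.Realize ![a, b]) w.1 w.2} :=
    pairs.subtypeEquiv fun x => realize_evenCycleFormula x
  rw [finitePairing, Nat.card_congr hsat]

variable {Ω : Type*} [MeasurableSpace Ω] (ν : Measure Ω) [IsProbabilityMeasure ν]

theorem measurePreserving_pi_pair {k : ℕ} {i j : Fin k} (hij : i ≠ j) :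
    MeasurePreserving (fun x : Fin k → Ω => (x i, x j)) (Measure.pi fun _ => ν) (ν.prod ν) := by
  refine ⟨by fun_prop, ?_⟩
  have hind := ProbabilityTheory.iIndepFun_pi (μ := fun _ : Fin k => ν) (X := fun _ => id)
    (fun _ => aemeasurable_id)
  have h := (hind.indepFun hij).map_prod_eq_prod_map_map
    (measurable_pi_apply i).aemeasurable (measurable_pi_apply j).aemeasurable
  rw [h, (measurePreserving_eval (fun _ => ν) i).map_eq,
    (measurePreserving_eval (fun _ => ν) j).map_eq]

theorem measurePreserving_pi_pair_pair :
    MeasurePreserving (fun x : Fin 4 → Ω => ((x 0, x 1), (x 2, x 3))) (Measure.pi fun _ => ν)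
      ((ν.prod ν).prod (ν.prod ν)) := by
  refine ⟨by fun_prop, ?_⟩
  have hind := ProbabilityTheory.iIndepFun_pi (μ := fun _ : Fin 4 => ν) (X := fun _ => id)
    (fun _ => aemeasurable_id)
  have h := (hind.indepFun_prodMk_prodMk (fun i => measurable_pi_apply i) 0 1 2 3 (by decide)
    (by decide) (by decide) (by decide)).map_prod_eq_prod_map_map (by fun_prop) (by fun_prop)
  simp only [id] at h
  rw [h, (measurePreserving_pi_pair ν (by decide : (0 : Fin 4) ≠ 1)).map_eq,
    (measurePreserving_pi_pair ν (by decide : (2 : Fin 4) ≠ 3)).map_eq]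

variable {ν} in
theorem measureReal_evenCycleFormula_ne_one_half [matroidLanguage.Structure Ω]
    (hadj : NullMeasurableSet {x : Fin 2 → Ω | adjFormula.Realize x} (Measure.pi fun _ => ν)) :
    (Measure.pi fun _ => ν).real {x : Fin 4 → Ω | evenCycleFormula.Realize x} ≠ 1 / 2 := by
  have hR : NullMeasurableSet {p : Ω × Ω | adjFormula.Realize ![p.1, p.2]} (ν.prod ν) :=
    hadj.preimage (measurePreserving_finTwoArrow ν).symm.quasiMeasurePreserving
  have hpairs := (measurePreserving_pi_pair_pair ν).measure_preimage
    (nullMeasurableSet_evenFourCycle (R := fun a b => adjFormula.Realize ![a, b]) hR)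
  simp only [realize_evenCycleFormula]
  exact fun h => measureReal_evenFourCycle_ne_one_half hR
    ((congrArg ENNReal.toReal hpairs).symm.trans h)

end EvenCyclePairing

theorem linearIndependent_zmod_two_triple_iff {V : Type*} [AddCommGroup V] [Module (ZMod 2) V]
    {a b c : V} (ha : a ≠ 0) (hb : b ≠ 0) (hc : c ≠ 0) (hab : a ≠ b) (hac : a ≠ c) (hbc : b ≠ c) :
    LinearIndependent (ZMod 2) ![a, b, c] ↔ a + b ≠ c := by
  have hsum : ∀ x y : V, x + y = 0 ↔ x = y := fun x y => by
    rw [add_eq_zero_iff_eq_neg, ZModModule.neg_eq_self]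
  rw [Fintype.linearIndependent_iff]
  constructor
  · intro h h0
    simpa using h (fun _ => 1) (by simpa [Fin.sum_univ_three, hsum] using h0) 0
  · intro h g hg
    have h01 : ∀ r : ZMod 2, r = 0 ∨ r = 1 := by decide
    have hzero : g 0 = 0 ∧ g 1 = 0 ∧ g 2 = 0 := by
      revert hg
      rw [Fin.sum_univ_three]
      rcases h01 (g 0) with h0 | h0 <;> rcases h01 (g 1) with h1 | h1 <;>
        rcases h01 (g 2) with h2 | h2 <;> simp [h0, h1, h2, ha, hb, hc, hsum, hab, hac, hbc, h]
    simpa [Fin.forall_fin_succ] using hzero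

section QuadricMatroid

open QuadraticMap

variable {W : Type*} [AddCommGroup W] [Module (ZMod 2) W] {Q : QuadraticForm (ZMod 2) W} {a b : W}

theorem ne_zero_of_mem_quadric (ha : a ∈ quadric Q) : a ≠ 0 := by
  rintro rfl
  exact zero_ne_one ((map_zero Q).symm.trans ha)

theorem add_mem_quadric_iff (ha : a ∈ quadric Q) (hb : b ∈ quadric Q) :
    a + b ∈ quadric Q ↔ polar Q a b = 1 := by
  have ha' : Q a = 1 := ha
  have hb' : Q b = 1 := hb
  have hadd : Q (a + b) = polar Q a b := by
    rw [QuadraticMap.map_add Q, ha', hb', CharTwo.add_self_eq_zero, zero_add]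
  rw [← hadd]
  rfl

theorem ne_of_polar_eq_one (h : polar Q a b = 1) : a ≠ b := by
  rintro rfl
  rw [polar_self, two_nsmul, CharTwo.add_self_eq_zero] at h
  exact zero_ne_one h

variable [Finite W]

variable (Q) in
/-- The binary matroid formed by the vectors of a quadric. -/
def quadricMatroid : Matroid W := linearMatroid (ZMod 2) (Set.toFinite (quadric Q)) id

theorem relMap_quadricMatroid_iff {x y z : (quadricMatroid Q).E} (hxy : x ≠ y) (hxz : x ≠ z)
    (hyz : y ≠ z) :
    letI := groundStructure (quadricMatroid Q)
    FirstOrder.Language.Structure.RelMap (L := matroidLanguage) (IndepSymbol.indep 2) ![x, y, z] ↔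
      (x + y : W) ≠ z := by
  have htriple : (fun i => (![x, y, z] i : W)) = ![(x : W), y, z] := by
    funext i
    fin_cases i <;> rfl
  refine (indepTuple_linearMatroid_iff fun i => (![x, y, z] i).2).trans ?_
  simp only [id]
  rw [htriple]
  exact linearIndependent_zmod_two_triple_iff (ne_zero_of_mem_quadric x.2)
    (ne_zero_of_mem_quadric y.2) (ne_zero_of_mem_quadric z.2) (Subtype.coe_ne_coe.2 hxy)
    (Subtype.coe_ne_coe.2 hxz) (Subtype.coe_ne_coe.2 hyz)

theorem realize_adjFormula_quadricMatroid_iff (x y : (quadricMatroid Q).E) :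
    letI := groundStructure (quadricMatroid Q)
    adjFormula.Realize ![x, y] ↔ QuadricAdj Q x y := by
  let := groundStructure (quadricMatroid Q)
  refine (realize_lineFormula (L := matroidLanguage) _ _ _).trans ?_
  refine Iff.trans ?_ (add_mem_quadric_iff x.2 y.2)
  constructor
  · rintro ⟨z, hxy, hxz, hyz, hz⟩
    rw [relMap_quadricMatroid_iff hxy hxz hyz, not_not] at hz
    exact hz ▸ z.2
  · intro hadd
    let z : (quadricMatroid Q).E := ⟨x + y, hadd⟩
    have hxy : x ≠ y := fun h =>
      ne_of_polar_eq_one ((add_mem_quadric_iff x.2 y.2).1 hadd) (congrArg Subtype.val h)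
    have hxz : x ≠ z := fun h =>
      ne_zero_of_mem_quadric y.2 (left_eq_add.1 (congrArg Subtype.val h))
    have hyz : y ≠ z := fun h =>
      ne_zero_of_mem_quadric x.2 (right_eq_add.1 (congrArg Subtype.val h))
    refine ⟨z, hxy, hxz, hyz, ?_⟩
    rw [relMap_quadricMatroid_iff hxy hxz hyz, not_not]

theorem abs_two_mul_finitePairing_quadricMatroid_sub_one_le (hQ : Q.polarBilin.SeparatingLeft)
    (hW : 4 ≤ Nat.card W) :
    |2 * finitePairing (quadricMatroid Q) evenCycleFormula - 1| ≤ 8 / (Nat.card W : ℝ) := by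
  have := Fintype.ofFinite W
  rw [finitePairing_evenCycleFormula, Nat.card_eq_fintype_card (α := W)]
  simp only [realize_adjFormula_quadricMatroid_iff]
  rw [Nat.card_eq_fintype_card] at hW
  have h := abs_two_mul_density_evenFourCycle_quadricAdj_sub_one_le hQ hW
  rw [← Nat.card_eq_fintype_card (α := quadric Q)] at h
  exact h

end QuadricMatroid

section Convergence

open FirstOrder.Language

instance : Countable matroidLanguage.Symbols := by
  have hfun : ∀ k, Countable (matroidLanguage.Functions k) := fun _ =>
    inferInstanceAs (Countable Empty)
  have hrel : ∀ k, Countable (matroidLanguage.Relations k) := fun k =>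
    have : Subsingleton (IndepSymbol k) := ⟨fun a b => by cases a; cases b; rfl⟩
    inferInstanceAs (Countable (IndepSymbol k))
  exact inferInstanceAs (Countable ((Σ k, _) ⊕ (Σ k, _)))

theorem finitePairing_mem_Icc {α : Type*} {M : Matroid α} (hM : M.E.Finite) {k : ℕ}
    (φ : matroidLanguage.Formula (Fin k)) : finitePairing M φ ∈ Set.Icc (0 : ℝ) 1 := by
  let := groundStructure M
  have := hM.to_subtype
  have hcard := Finite.card_subtype_le fun x : Fin k → M.E => φ.Realize x
  rw [Nat.card_fun, Nat.card_fin] at hcard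
  exact ⟨by unfold finitePairing; positivity,
    div_le_one_of_le₀ (by exact_mod_cast hcard) (by positivity)⟩

theorem exists_strictMono_foConvergent {α : Type*} (M : ℕ → Matroid α)
    (hM : ∀ n, (M n).E.Finite) : ∃ s : ℕ → ℕ, StrictMono s ∧ FOConvergent (M ∘ s) := by
  let P : ℕ → (Σ k, matroidLanguage.Formula (Fin k)) → ℝ := fun n φ => finitePairing (M n) φ.2
  have hP : ∀ n, P n ∈ Set.univ.pi fun _ => Set.Icc (0 : ℝ) 1 := fun n φ _ =>
    finitePairing_mem_Icc (hM n) φ.2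
  obtain ⟨l, -, s, hs, hl⟩ := (isCompact_univ_pi fun _ => isCompact_Icc).tendsto_subseq hP
  exact ⟨s, hs, fun k φ => ⟨l ⟨k, φ⟩, tendsto_pi_nhds.1 hl ⟨k, φ⟩⟩⟩

end Convergence

theorem exists_isBinary_abs_two_mul_finitePairing_sub_one_le (n : ℕ) :
    ∃ M : Matroid ℕ, (M.E.Finite ∧ M.E.Nonempty ∧ IsBinary M) ∧
      |2 * finitePairing M evenCycleFormula - 1| ≤ 2 / 4 ^ n := by
  let V := Fin (n + 1) → ZMod 2
  let W := Module.Dual (ZMod 2) V × V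
  let Q : QuadraticForm (ZMod 2) W := QuadraticForm.dualProd (ZMod 2) V
  have : Finite W := Module.finite_of_finite (ZMod 2)
  obtain ⟨g⟩ := nonempty_embedding_nat W
  have hQ : Q.polarBilin.SeparatingLeft := separatingLeft_polarBilin_dualProd (ZMod 2) V
  have hcard : Nat.card W = 4 ^ (n + 1) := by
    rw [Module.natCard_eq_pow_finrank (K := ZMod 2), Module.finrank_prod,
      Subspace.dual_finrank_eq, Module.finrank_fin_fun, Nat.card_zmod, ← two_mul, pow_mul]
    norm_num
  have hW : 4 ≤ Nat.card W := hcard ▸ Nat.le_self_pow n.succ_ne_zero 4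
  have hne : (quadric Q).Nonempty :=
    have := Fintype.ofFinite W
    nonempty_quadric hQ (by rwa [← Nat.card_eq_fintype_card])
  refine ⟨(quadricMatroid Q).mapEmbedding g,
    ⟨(Set.toFinite (quadric Q)).image g, hne.image g,
      isRepresentable_linearMatroid.mapEmbedding g⟩, ?_⟩
  rw [finitePairing_mapEmbedding]
  refine (abs_two_mul_finitePairing_quadricMatroid_sub_one_le hQ hW).trans_eq ?_
  rw [hcard, Nat.cast_pow, pow_succ]
  field_simp
  ring

theorem exists_seq_isBinary_tendsto_finitePairing_one_half :
    ∃ M : ℕ → Matroid ℕ, (∀ n, (M n).E.Finite ∧ (M n).E.Nonempty ∧ IsBinary (M n)) ∧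
      Tendsto (fun n => finitePairing (M n) evenCycleFormula) atTop (𝓝 (1 / 2)) := by
  choose M hM hbound using exists_isBinary_abs_two_mul_finitePairing_sub_one_le
  refine ⟨M, hM, ?_⟩
  have hzero : Tendsto (fun n : ℕ => (2 : ℝ) / 4 ^ n) atTop (𝓝 0) :=
    tendsto_const_nhds.div_atTop (tendsto_pow_atTop_atTop_of_one_lt (by norm_num))
  have hdiff : Tendsto (fun n => 2 * finitePairing (M n) evenCycleFormula - 1) atTop (𝓝 0) :=
    squeeze_zero_norm hbound hzero
  have hlim := (hdiff.add_const 1).div_const 2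
  simpa using hlim

end FOMatroid

theorem theoremt_general :
    ∃ M : ℕ → Matroid ℕ,
      (∀ n, (M n).E.Finite ∧ (M n).E.Nonempty ∧ FOMatroid.IsBinary (M n)) ∧
      FOMatroid.FOConvergent M ∧
      ∀ (Ω : Type u) [MeasurableSpace Ω] [FOMatroid.matroidLanguage.Structure Ω]
        (ν : MeasureTheory.Measure Ω) [MeasureTheory.IsProbabilityMeasure ν],
        (∀ (k : ℕ) (φ : FOMatroid.matroidLanguage.Formula (Fin k)),
          MeasureTheory.NullMeasurableSet {x : Fin k → Ω | φ.Realize x}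
            (MeasureTheory.Measure.pi fun _ => ν)) →
        ¬ ∀ (k : ℕ) (φ : FOMatroid.matroidLanguage.Formula (Fin k)),
          Filter.Tendsto (fun n => FOMatroid.finitePairing (M n) φ) Filter.atTop
            (nhds ((MeasureTheory.Measure.pi fun _ => ν).real {x : Fin k → Ω | φ.Realize x})) := by
  obtain ⟨M, hM, hhalf⟩ := FOMatroid.exists_seq_isBinary_tendsto_finitePairing_one_half
  obtain ⟨s, hs, hconv⟩ := FOMatroid.exists_strictMono_foConvergent M fun n => (hM n).1
  refine ⟨M ∘ s, fun n => hM (s n), hconv, fun Ω _ _ ν _ hmeas hlim => ?_⟩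
  exact FOMatroid.measureReal_evenCycleFormula_ne_one_half (hmeas 2 FOMatroid.adjFormula)
    (tendsto_nhds_unique (hlim 4 FOMatroid.evenCycleFormula) (hhalf.comp hs.tendsto_atTop))

theorem theoremt :
    ∃ M : ℕ → Matroid ℕ,
      (∀ n, (M n).E.Finite ∧ (M n).E.Nonempty ∧ FOMatroid.IsBinary (M n)) ∧
      FOMatroid.FOConvergent M ∧
      ¬ ∃ A : FOMatroid.Modeling.{u} FOMatroid.matroidLanguage, FOMatroid.IsLimitModeling A M := by
  obtain ⟨M, hM, hconv, hno⟩ := theoremt_general.{u}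
  exact ⟨M, hM, hconv, fun ⟨A, hA⟩ => hno A.carrier A.ν A.measurable_realize hA.2⟩
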